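/- Let $a=(a_k)_{k\ge 0}$ and $c=(c_k)_{k\ge 0}$ be real $2$-periodic sequences (that is, $a_{k+2}=a_k$ and $c_{k+2}=c_k$ for all $k\ge 0$) and let $b$ be the constant $0$ sequence. Let $T(a,b,c)$ be the bounded operator on the complex Hilbert space $\ell^2(\mathbb N_0)$ given by the tridiagonal matrix whose row $k$ has the entries $a_k$, $b_k$, $c_k$ in columns $k-1$, $k$, $k+1$ (for $k=0$ only $b_0$, $c_0$ in columns $0$, $1$). For a bounded operator $A$ on a complex Hilbert space put $W(A)=\{\langle Ax,x\rangle : \|x\|=1\}$; square complex matrices are regarded as operators on $\mathbb C^m$ with the Euclidean inner product. Set \[ \alpha_0=\frac{c_0+\overline{a_1}}{2},\quad \gamma_0=\frac{c_0-\overline{a_1}}{2i},\quad \alpha_1=\frac{a_0+\overline{c_1}}{2},\quad \gamma_1=\frac{a_0-\overline{c_1}}{2i} \] and \[ S=\begin{pmatrix} \alpha_0+\alpha_1 & -\gamma_0 & -\gamma_1 & 0\\ -\gamma_0 & -\alpha_0+\alpha_1 & 0 & -\gamma_1\\ -\gamma_1 & 0 & \alpha_0-\alpha_1 & -\gamma_0\\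 0 & -\gamma_1 & -\gamma_0 & -\alpha_0-\alpha_1 \end{pmatrix}. \] Then $\overline{W(T(a,b,c))}=W(S)$. -/

import Mathlib

open scoped ComplexConjugate ENNReal

/-- The Hilbert space `ℓ²(ℕ₀)` of square-summable complex sequences. -/
abbrev Ell2 : Type := lp (fun _ : ℕ => ℂ) 2

/-- The numerical range `W(A) = {⟨A x, x⟩ : ‖x‖ = 1}` of a bounded operator on a complex inner
product space. The bracket `⟨u, v⟩`, linear in `u`, is Mathlib's `inner ℂ v u`. -/
def numericalRange {H : Type*} [NormedAddCommGroup H] [InnerProductSpace ℂ H]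
    (A : H →L[ℂ] H) : Set ℂ :=
  {z | ∃ x : H, ‖x‖ = 1 ∧ inner ℂ x (A x) = z}

/-- The numerical range of a square complex matrix, acting on `ℂᵐ` with the Euclidean norm. -/
noncomputable def matrixNumericalRange {m : ℕ} (A : Matrix (Fin m) (Fin m) ℂ) : Set ℂ :=
  numericalRange (Matrix.toEuclideanCLM (n := Fin m) (𝕜 := ℂ) A)

/-- The formal action of the infinite tridiagonal matrix whose row `k` has the entries
`a k`, `b k`, `c k` in the columns `k - 1`, `k`, `k + 1` (row `0` has no entry `a 0`). -/
def tridiagAct (a b c : ℕ → ℂ) (x : ℕ → ℂ) : ℕ → ℂ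
  | 0 => b 0 * x 0 + c 0 * x 1
  | k + 1 => a (k + 1) * x k + b (k + 1) * x (k + 1) + c (k + 1) * x (k + 2)

theorem periodic_norm_le {a : ℕ → ℂ} {n : ℕ} (ha : Function.Periodic a (n + 1)) :
    ∃ M : ℝ, ∀ k, ‖a k‖ ≤ M := by
  refine ⟨∑ i ∈ Finset.range (n + 1), ‖a i‖, fun k => ?_⟩
  rw [← ha.map_mod_nat k]
  exact Finset.single_le_sum (f := fun i => ‖a i‖) (fun i _ => norm_nonneg _)
    (Finset.mem_range.2 (Nat.mod_lt _ n.succ_pos))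

theorem memlp_two_iff (u : ℕ → ℂ) :
    Memℓp u 2 ↔ Summable fun k => ‖u k‖ ^ 2 := by
  rw [memℓp_gen_iff (by norm_num)]
  norm_num

theorem memlp_mul_of_bounded {w u : ℕ → ℂ} (hw : ∃ M : ℝ, ∀ k, ‖w k‖ ≤ M)
    (hu : Memℓp u 2) : Memℓp (fun k => w k * u k) 2 := by
  obtain ⟨M, hM⟩ := hw
  rw [memlp_two_iff] at hu ⊢
  refine Summable.of_nonneg_of_le (fun k => by positivity) (fun k => ?_) (hu.mul_left (M ^ 2))
  rw [norm_mul, mul_pow]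
  gcongr
  exact hM k

theorem memlp_tridiagAct {a b c : ℕ → ℂ} {n : ℕ} (ha : Function.Periodic a (n + 1))
    (hb : Function.Periodic b (n + 1)) (hc : Function.Periodic c (n + 1)) (x : Ell2) :
    Memℓp (tridiagAct a b c x) 2 := by
  have hx : Memℓp (fun k => x k) 2 := lp.memℓp x
  have hs := (memlp_two_iff _).1 hx
  have hup : Memℓp (fun k => x (k + 1)) 2 :=
    (memlp_two_iff _).2 ((summable_nat_add_iff 1).2 hs)
  have hdown : Memℓp (fun k => if k = 0 then (0 : ℂ) else x (k - 1)) 2 :=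
    (memlp_two_iff _).2 ((summable_nat_add_iff 1).1 (by simpa using hs))
  have h := ((memlp_mul_of_bounded (periodic_norm_le ha) hdown).add
    (memlp_mul_of_bounded (periodic_norm_le hb) hx)).add
    (memlp_mul_of_bounded (periodic_norm_le hc) hup)
  convert h using 1
  funext k
  cases k <;> simp [tridiagAct]

/-- The tridiagonal operator with periodic entries, as a linear map of `ℓ²(ℕ₀)`. -/
def tridiagLin {n : ℕ} {a b c : ℕ → ℂ} (ha : Function.Periodic a (n + 1))
    (hb : Function.Periodic b (n + 1)) (hc : Function.Periodic c (n + 1)) : Ell2 →ₗ[ℂ] Ell2 where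
  toFun x := ⟨tridiagAct a b c x, memlp_tridiagAct ha hb hc x⟩
  map_add' x y := by
    ext k
    change tridiagAct a b c (x + y : Ell2) k = tridiagAct a b c x k + tridiagAct a b c y k
    cases k <;> simp [tridiagAct] <;> ring
  map_smul' r x := by
    ext k
    cases k <;> simp [tridiagAct] <;> ring

theorem tridiagLin_apply {n : ℕ} {a b c : ℕ → ℂ} (ha : Function.Periodic a (n + 1))
    (hb : Function.Periodic b (n + 1)) (hc : Function.Periodic c (n + 1)) (x : Ell2) (k : ℕ) :
    tridiagLin ha hb hc x k = tridiagAct a b c x k := rfl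

theorem continuous_tridiagLin {n : ℕ} {a b c : ℕ → ℂ} (ha : Function.Periodic a (n + 1))
    (hb : Function.Periodic b (n + 1)) (hc : Function.Periodic c (n + 1)) :
    Continuous (tridiagLin ha hb hc) := by
  refine LinearMap.continuous_of_seq_closed_graph _ fun u x y hu hTu => ?_
  have coord : ∀ k, Continuous fun z : Ell2 => z k := fun k =>
    (lp.evalCLM ℂ (fun _ : ℕ => ℂ) 2 k).continuous
  ext k
  have hx : ∀ j, Filter.Tendsto (fun i => u i j) Filter.atTop (nhds (x j)) := fun j =>
    ((coord j).tendsto x).comp hu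
  have hy : Filter.Tendsto (fun i => tridiagAct a b c (u i) k) Filter.atTop (nhds (y k)) :=
    ((coord k).tendsto y).comp hTu
  refine tendsto_nhds_unique hy ?_
  rw [tridiagLin_apply]
  cases k with
  | zero => exact ((hx 0).const_mul _).add ((hx 1).const_mul _)
  | succ k =>
    exact (((hx k).const_mul _).add ((hx (k + 1)).const_mul _)).add ((hx (k + 2)).const_mul _)

/-- The `(n + 1)`-periodic tridiagonal operator `T(a, b, c)`, as a bounded operator on `ℓ²(ℕ₀)`. -/
def tridiagOp {n : ℕ} {a b c : ℕ → ℂ} (ha : Function.Periodic a (n + 1))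
    (hb : Function.Periodic b (n + 1)) (hc : Function.Periodic c (n + 1)) : Ell2 →L[ℂ] Ell2 where
  toLinearMap := tridiagLin ha hb hc
  cont := continuous_tridiagLin ha hb hc

/-- `α_j = (c_j + conj a_{j+1}) / 2` for `j < n`, and `α_n = (a_0 + conj c_n) / 2`. -/
noncomputable def alphaCoeff (n : ℕ) (a c : ℕ → ℂ) (j : ℕ) : ℂ :=
  if j < n then (c j + conj (a (j + 1))) / 2 else (a 0 + conj (c n)) / 2

/-- `γ_j = (c_j - conj a_{j+1}) / (2i)` for `j < n`, and `γ_n = (a_0 - conj c_n) / (2i)`. -/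
noncomputable def gammaCoeff (n : ℕ) (a c : ℕ → ℂ) (j : ℕ) : ℂ :=
  if j < n then (c j - conj (a (j + 1))) / (2 * Complex.I)
  else (a 0 - conj (c n)) / (2 * Complex.I)

/-- The explicit `4 × 4` matrix `S` with entries built from `α₀, α₁, γ₀, γ₁`. -/
def matrixS (α₀ α₁ γ₀ γ₁ : ℂ) : Matrix (Fin 4) (Fin 4) ℂ :=
  !![α₀ + α₁, -γ₀, -γ₁, 0;
     -γ₀, -α₀ + α₁, 0, -γ₁;
     -γ₁, 0, α₀ - α₁, -γ₀;
     0, -γ₁, -γ₀, -α₀ - α₁]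

/-! Both sides equal the Minkowski sum of two elliptical discs, `ellipseSum`. Since `b = 0`, the
form `⟨Tx, x⟩` is a sum over edges `(k, k+1)` of `ellipseForm` at `2 x_{k+1} x̄_k`
(`inner_tridiagOp`). Even and odd edges carry the coefficients `(c₀, a₁)` and `(c₁, a₀)`, so each
class collapses by real-linearity to one argument, of modulus at most 1. Conversely, long vectors of
constant modulus with suitable phases approximate every such pair of arguments; compactness of the
sum settles the closure. The matrix is a Kronecker sum `I ⊗ A₀ + A₁ ⊗ I`, where `A_j` has rows
`(α_j, -γ_j)`, `(-γ_j, -α_j)`. Product vectors decouple the two summands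
(`matrixNumericalRange_matrixS`). -/

/-- The real-linear form `s ↦ (c s + a s̄) / 2`, which maps the closed unit disc onto the closed
elliptical disc with semi-axes `|c + a| / 2` and `|c - a| / 2` when `a` and `c` are real. -/
noncomputable def ellipseForm (c a s : ℂ) : ℂ := (c * s + a * conj s) / 2

/-- The Minkowski sum of the images of the closed unit disc under two elliptic forms. -/
def ellipseSum (c₀ a₀ c₁ a₁ : ℂ) : Set ℂ :=
  {z | ∃ p q : ℂ, ‖p‖ ≤ 1 ∧ ‖q‖ ≤ 1 ∧ ellipseForm c₀ a₀ p + ellipseForm c₁ a₁ q = z}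

theorem isCompact_ellipseSum (c₀ a₀ c₁ a₁ : ℂ) : IsCompact (ellipseSum c₀ a₀ c₁ a₁) := by
  have hK : IsCompact (Metric.closedBall (0 : ℂ) 1 ×ˢ Metric.closedBall (0 : ℂ) 1) :=
    (isCompact_closedBall 0 1).prod (isCompact_closedBall 0 1)
  have hf : Continuous fun r : ℂ × ℂ => ellipseForm c₀ a₀ r.1 + ellipseForm c₁ a₁ r.2 := by
    unfold ellipseForm
    fun_prop
  convert hK.image hf using 1
  ext z
  simp [ellipseSum, and_assoc]

/-! ### Parametrizations of the closed unit disc. -/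

/-- Every point of the closed unit disc is the midpoint of two points of the unit circle. -/
theorem exists_unit_midpoint {p : ℂ} (hp : ‖p‖ ≤ 1) :
    ∃ ζ η : ℂ, ‖ζ‖ = 1 ∧ ‖η‖ = 1 ∧ ζ + η = 2 * p := by
  have hs : (0 : ℝ) ≤ 1 - ‖p‖ ^ 2 := by nlinarith [norm_nonneg p]
  have hn : ∀ t : ℝ, t ^ 2 = 1 - ‖p‖ ^ 2 →
      ‖Complex.exp (Complex.arg p * Complex.I) * (‖p‖ + t * Complex.I)‖ = 1 := by
    intro t ht
    rw [norm_mul, Complex.norm_exp_ofReal_mul_I, one_mul, Complex.norm_add_mul_I, ht]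
    simp
  refine ⟨_, _, hn (√(1 - ‖p‖ ^ 2)) (Real.sq_sqrt hs),
    hn (-√(1 - ‖p‖ ^ 2)) (by rw [neg_sq, Real.sq_sqrt hs]), ?_⟩
  conv_rhs => rw [← Complex.norm_mul_exp_arg_mul_I p]
  push_cast
  ring

/-- Every point `p` of the closed unit disc is `(|y|² - |z|²) + i (y z̄ + z ȳ)` for some unit
vector `(y, z)`. -/
theorem exists_unit_vector_of_norm_le_one {p : ℂ} (hp : ‖p‖ ≤ 1) :
    ∃ y z : ℂ, conj y * y + conj z * z = 1 ∧ conj y * y - conj z * z = p.re ∧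
      conj y * z + conj z * y = p.im := by
  have hs : (0 : ℝ) ≤ 1 - ‖p‖ ^ 2 := by nlinarith [norm_nonneg p]
  -- The witnesses satisfy `y + iz = t` and `y - iz = p̄ / t`. The last two identities then hold for
  -- every `t ≠ 0`, and the quartic is the normalization. Its larger root in `t²` is nonzero even at
  -- `p = 0`.
  obtain ⟨t, ht0, ht⟩ : ∃ t : ℝ, t ≠ 0 ∧ t ^ 4 - 2 * t ^ 2 + ‖p‖ ^ 2 = 0 := by
    have h1 : 0 ≤ √(1 - ‖p‖ ^ 2) := Real.sqrt_nonneg _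
    have h2 := Real.sq_sqrt hs
    refine ⟨√(1 + √(1 - ‖p‖ ^ 2)), by positivity, ?_⟩
    have h3 := Real.sq_sqrt (show 0 ≤ 1 + √(1 - ‖p‖ ^ 2) by positivity)
    rw [show ∀ x : ℝ, x ^ 4 = (x ^ 2) ^ 2 by intro x; ring, h3]
    nlinarith
  rw [← Complex.normSq_eq_norm_sq, Complex.normSq_apply] at ht
  refine ⟨⟨(t + p.re / t) / 2, -(p.im / t) / 2⟩, ⟨(p.im / t) / 2, -(t - p.re / t) / 2⟩, ?_, ?_, ?_⟩
  all_goals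
    apply Complex.ext <;> simp <;> field_simp <;> ring_nf <;> try linarith

/-- Follows from `(|y|² - |z|²)² + 4|y|²|z|² = (|y|² + |z|²)²`. -/
theorem norm_blochVector_le (y z : ℂ) :
    ‖(⟨‖y‖ ^ 2 - ‖z‖ ^ 2, 2 * (conj y * z).re⟩ : ℂ)‖ ≤ ‖y‖ ^ 2 + ‖z‖ ^ 2 := by
  apply abs_le_of_sq_le_sq' _ (by positivity) |>.2
  have h : (conj y * z).re ^ 2 ≤ (‖y‖ * ‖z‖) ^ 2 := by
    rw [sq_le_sq, abs_of_nonneg (by positivity : 0 ≤ ‖y‖ * ‖z‖)]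
    simpa using Complex.abs_re_le_norm (conj y * z)
  rw [← Complex.normSq_eq_norm_sq ⟨_, _⟩, Complex.normSq_mk]
  nlinarith

theorem ellipseForm_two_mul (c a s : ℂ) : ellipseForm c a (2 * s) = c * s + a * conj s := by
  rw [ellipseForm, map_mul, Complex.conj_ofNat]
  ring

theorem ellipseForm_eq_re_add_im (c a s : ℂ) :
    ellipseForm c a s = (c + a) / 2 * s.re - (c - a) / (2 * Complex.I) * s.im := by
  have h2 : conj s = s.re - s.im * Complex.I := by
    apply Complex.ext <;> simp
  have h3 : (c - a) / (2 * Complex.I) = -((c - a) / 2 * Complex.I) := by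
    rw [div_mul_eq_div_div, Complex.div_I]
  rw [ellipseForm, h2, h3]
  nth_rewrite 1 [← Complex.re_add_im s]
  ring

/-! ### The numerical range of the matrix. -/

theorem inner_matrixS (α₀ α₁ γ₀ γ₁ : ℂ) (x : EuclideanSpace ℂ (Fin 4)) :
    inner ℂ x (Matrix.toEuclideanCLM (n := Fin 4) (𝕜 := ℂ) (matrixS α₀ α₁ γ₀ γ₁) x) =
      α₀ * (conj (x 0) * x 0 - conj (x 1) * x 1 + (conj (x 2) * x 2 - conj (x 3) * x 3))
      - γ₀ * (conj (x 0) * x 1 + conj (x 1) * x 0 + (conj (x 2) * x 3 + conj (x 3) * x 2))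
      + (α₁ * (conj (x 0) * x 0 - conj (x 2) * x 2 + (conj (x 1) * x 1 - conj (x 3) * x 3))
      - γ₁ * (conj (x 0) * x 2 + conj (x 2) * x 0 + (conj (x 1) * x 3 + conj (x 3) * x 1))) := by
  rw [PiLp.inner_apply]
  simp only [Matrix.ofLp_toEuclideanCLM, Fin.sum_univ_four, RCLike.inner_apply, matrixS,
    Matrix.mulVec, dotProduct, Matrix.of_apply, Matrix.cons_val]
  ring

theorem conj_mul_add_conj_mul (y z : ℂ) :
    conj y * z + conj z * y = ((2 * (conj y * z).re : ℝ) : ℂ) := by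
  have h := Complex.add_conj (conj y * z)
  rw [map_mul, Complex.conj_conj, mul_comm y] at h
  exact h

/-- The numerical range of the `4 × 4` matrix is a sum of two elliptical discs. -/
theorem matrixNumericalRange_matrixS (a₀ a₁ c₀ c₁ : ℂ) :
    matrixNumericalRange (matrixS ((c₀ + a₁) / 2) ((a₀ + c₁) / 2)
      ((c₀ - a₁) / (2 * Complex.I)) ((a₀ - c₁) / (2 * Complex.I))) =
      ellipseSum c₀ a₁ c₁ a₀ := by
  ext w
  constructor
  · rintro ⟨x, hx, rfl⟩
    have hx2 : ‖x 0‖ ^ 2 + ‖x 1‖ ^ 2 + ‖x 2‖ ^ 2 + ‖x 3‖ ^ 2 = 1 := by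
      rw [← Fin.sum_univ_four (fun i => ‖x i‖ ^ 2), ← EuclideanSpace.norm_sq_eq, hx, one_pow]
    set B : ℂ → ℂ → ℂ := fun y z => ⟨‖y‖ ^ 2 - ‖z‖ ^ 2, 2 * (conj y * z).re⟩ with hB
    have hBn : ∀ y z, ‖B y z‖ ≤ ‖y‖ ^ 2 + ‖z‖ ^ 2 := norm_blochVector_le
    -- The conjugate appears because `γ₁` is built from `a₀ - c₁`, the opposite sign to `ellipseForm
    -- c₁ a₀`.
    refine ⟨B (x 0) (x 1) + B (x 2) (x 3), conj (B (x 0) (x 2) + B (x 1) (x 3)), ?_, ?_, ?_⟩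
    · linarith [norm_add_le (B (x 0) (x 1)) (B (x 2) (x 3)), hBn (x 0) (x 1), hBn (x 2) (x 3)]
    · rw [Complex.norm_conj]
      linarith [norm_add_le (B (x 0) (x 2)) (B (x 1) (x 3)), hBn (x 0) (x 2), hBn (x 1) (x 3)]
    · rw [inner_matrixS]
      simp only [conj_mul_add_conj_mul, Complex.conj_mul', ellipseForm_eq_re_add_im, hB,
        Complex.add_re, Complex.add_im, Complex.conj_re, Complex.conj_im]
      push_cast
      ring
  · rintro ⟨p, q, hp, hq, rfl⟩
    obtain ⟨y₀, y₁, hy, hyr, hyi⟩ := exists_unit_vector_of_norm_le_one hp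
    obtain ⟨z₀, z₁, hz, hzr, hzi⟩ :=
      exists_unit_vector_of_norm_le_one (p := conj q) (by rwa [Complex.norm_conj])
    rw [Complex.conj_re] at hzr
    rw [Complex.conj_im, Complex.ofReal_neg] at hzi
    -- The product vector `z ⊗ y`: `y` sees only `α₀, γ₀` and `z` only `α₁, γ₁`.
    refine ⟨!₂[z₀ * y₀, z₀ * y₁, z₁ * y₀, z₁ * y₁], ?_, ?_⟩
    · rw [← sq_eq_sq₀ (norm_nonneg _) zero_le_one, EuclideanSpace.norm_sq_eq,
        Fin.sum_univ_four, ← Complex.ofReal_inj]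
      simp only [Complex.conj_mul'] at hy hz
      simp only [Matrix.cons_val, norm_mul]
      push_cast
      linear_combination (‖y₀‖ ^ 2 + ‖y₁‖ ^ 2 : ℂ) * hz + hy
    · rw [inner_matrixS, ellipseForm_eq_re_add_im, ellipseForm_eq_re_add_im, ← hyr, ← hyi, ← hzr]
      simp only [Matrix.cons_val, map_mul]
      linear_combination
        ((c₀ + a₁) / 2 * (conj y₀ * y₀ - conj y₁ * y₁)
          - (c₀ - a₁) / (2 * Complex.I) * (conj y₀ * y₁ + conj y₁ * y₀)) * hz
        + ((a₀ + c₁) / 2 * (conj z₀ * z₀ - conj z₁ * z₁)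
          - (a₀ - c₁) / (2 * Complex.I) * (conj z₀ * z₁ + conj z₁ * z₀)) * hy
        - (a₀ - c₁) / (2 * Complex.I) * hzi

/-! ### The quadratic form of the operator and its upper bound. -/

theorem Ell2.hasSum_norm_sq (x : Ell2) : HasSum (fun k => ‖x k‖ ^ 2) (‖x‖ ^ 2) := by
  simpa using lp.hasSum_norm (p := 2) (by norm_num) x

theorem norm_mul_conj_le (y z : ℂ) : ‖z * conj y‖ ≤ (‖y‖ ^ 2 + ‖z‖ ^ 2) / 2 := by
  rw [norm_mul, Complex.norm_conj]
  nlinarith [sq_nonneg (‖y‖ - ‖z‖)]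

theorem Ell2.summable_mul_conj (x : Ell2) : Summable fun k => x (k + 1) * conj (x k) := by
  have hs := (Ell2.hasSum_norm_sq x).summable
  exact Summable.of_norm_bounded ((hs.add ((summable_nat_add_iff 1).2 hs)).div_const 2)
    fun k => norm_mul_conj_le _ _

theorem inner_tridiagOp {n : ℕ} {a b c : ℕ → ℂ} (ha : Function.Periodic a (n + 1))
    (hb : Function.Periodic b (n + 1)) (hc : Function.Periodic c (n + 1))
    (hb_zero : ∀ k, b k = 0) (x : Ell2) :
    HasSum (fun k => ellipseForm (c k) (a (k + 1)) (2 * (x (k + 1) * conj (x k))))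
      (inner ℂ x (tridiagOp ha hb hc x)) := by
  have hw := Ell2.summable_mul_conj x
  have hwc : Summable fun k => conj (x (k + 1) * conj (x k)) := by
    simpa using hw.norm.of_norm_bounded (fun k => (Complex.norm_conj _).le)
  have hcw : Summable fun k => c k * (x (k + 1) * conj (x k)) := by
    obtain ⟨M, hM⟩ := periodic_norm_le hc
    refine Summable.of_norm_bounded (hw.norm.mul_left M) fun k => ?_
    rw [norm_mul]
    gcongr
    exact hM k
  have haw : Summable fun k => a (k + 1) * conj (x (k + 1) * conj (x k)) := by
    obtain ⟨M, hM⟩ := periodic_norm_le ha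
    refine Summable.of_norm_bounded (hwc.norm.mul_left M) fun k => ?_
    rw [norm_mul]
    gcongr
    exact hM _
  have hT := lp.hasSum_inner (𝕜 := ℂ) x (tridiagOp ha hb hc x)
  have h0 : ∀ k, tridiagOp ha hb hc x k = tridiagAct a b c x k := fun k => rfl
  simp only [h0, RCLike.inner_apply] at hT
  have key : inner ℂ x (tridiagOp ha hb hc x) =
      ∑' k, ellipseForm (c k) (a (k + 1)) (2 * (x (k + 1) * conj (x k))) := by
    calc _ = _ := hT.tsum_eq.symm
      -- Row `k + 1` contains the `a`-term of edge `k` but the `c`-term of edge `k + 1`; shifting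
      -- the `c`-sum aligns them.
      _ = c 0 * (x 1 * conj (x 0)) + ∑' k, (a (k + 1) * conj (x (k + 1) * conj (x k)) +
            c (k + 1) * (x (k + 2) * conj (x (k + 1)))) := by
          rw [hT.summable.tsum_eq_zero_add]
          congr 1
          · simp [tridiagAct, hb_zero]
            ring
          · refine tsum_congr fun k => ?_
            simp [tridiagAct, hb_zero]
            ring
      _ = (∑' k, c k * (x (k + 1) * conj (x k))) +
            ∑' k, a (k + 1) * conj (x (k + 1) * conj (x k)) := by
          rw [haw.tsum_add ((summable_nat_add_iff 1).2 hcw), hcw.tsum_eq_zero_add]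
          ring
      _ = _ := by
          rw [← hcw.tsum_add haw]
          exact tsum_congr fun k => (ellipseForm_two_mul _ _ _).symm
  rw [key]
  exact Summable.hasSum ((hcw.add haw).congr fun k =>
    (ellipseForm_two_mul _ _ (x (k + 1) * conj (x k))).symm)

theorem ellipseForm_hasSum {ι : Type*} {f : ι → ℂ} {s : ℂ} (c a : ℂ) (hf : HasSum f s) :
    HasSum (fun i => ellipseForm c a (f i)) (ellipseForm c a s) :=
  ((hf.mul_left c).add ((Complex.hasSum_conj'.2 (by simpa using hf)).mul_left a)).div_const 2

/-- Edges of equal parity are disjoint, so `2|yz| ≤ |y|² + |z|²` sums to at most `‖x‖² = 1`. -/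
theorem numericalRange_tridiagOp_subset {a b c : ℕ → ℂ} (ha : Function.Periodic a 2)
    (hb : Function.Periodic b 2) (hc : Function.Periodic c 2) (hb_zero : ∀ k, b k = 0) :
    numericalRange (tridiagOp (n := 1) ha hb hc) ⊆ ellipseSum (c 0) (a 1) (c 1) (a 0) := by
  rintro _ ⟨x, hx, rfl⟩
  have hn := Ell2.hasSum_norm_sq x
  rw [hx, one_pow] at hn
  have hw : Summable fun k => 2 * (x (k + 1) * conj (x k)) :=
    (Ell2.summable_mul_conj x).mul_left 2
  have he : Summable fun k => 2 * (x (2 * k + 1) * conj (x (2 * k))) :=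
    hw.comp_injective (mul_right_injective₀ (two_ne_zero' ℕ))
  have ho : Summable fun k => 2 * (x (2 * k + 1 + 1) * conj (x (2 * k + 1))) :=
    hw.comp_injective (i := fun k => 2 * k + 1) (fun i j h => by simpa using h)
  have hse : Summable fun k => ‖x (2 * k)‖ ^ 2 :=
    hn.summable.comp_injective (mul_right_injective₀ (two_ne_zero' ℕ))
  have hso : Summable fun k => ‖x (2 * k + 1)‖ ^ 2 :=
    hn.summable.comp_injective (i := fun k => 2 * k + 1) (fun i j h => by simpa using h)
  have hsum : ∑' k, ‖x (2 * k)‖ ^ 2 + ∑' k, ‖x (2 * k + 1)‖ ^ 2 = 1 := by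
    rw [tsum_even_add_odd (f := fun k => ‖x k‖ ^ 2) hse hso, hn.tsum_eq]
  have bound : ∀ y z : ℂ, ‖2 * (z * conj y)‖ ≤ ‖y‖ ^ 2 + ‖z‖ ^ 2 := fun y z => by
    have := norm_mul_conj_le y z
    rw [norm_mul, Complex.norm_two]
    linarith
  refine ⟨∑' k, 2 * (x (2 * k + 1) * conj (x (2 * k))),
    ∑' k, 2 * (x (2 * k + 1 + 1) * conj (x (2 * k + 1))), ?_, ?_, ?_⟩
  · exact (tsum_of_norm_bounded (hse.hasSum.add hso.hasSum) fun k => bound _ _).trans hsum.le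
  · have hse' : Summable fun k => ‖x (2 * k + 1 + 1)‖ ^ 2 := (summable_nat_add_iff 1).2 hse
    refine (tsum_of_norm_bounded (hso.hasSum.add hse'.hasSum) fun k => bound _ _).trans ?_
    rw [hse.tsum_eq_zero_add] at hsum
    -- The odd edges cover every coordinate except `x 0`.
    have h0 : 0 ≤ ‖x (2 * 0)‖ ^ 2 := by positivity
    have h2 : ∑' k, ‖x (2 * k + 1 + 1)‖ ^ 2 = ∑' k, ‖x (2 * (k + 1))‖ ^ 2 := rfl
    linarith
  · refine HasSum.unique (HasSum.even_add_odd ?_ ?_) (inner_tridiagOp ha hb hc hb_zero x)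
    · have h := ellipseForm_hasSum (c 0) (a 1) he.hasSum
      convert h using 3 with k
      · rw [← hc.map_mod_nat]; congr 1; omega
      · rw [← ha.map_mod_nat]; congr 1; omega
    · have h := ellipseForm_hasSum (c 1) (a 0) ho.hasSum
      convert h using 3 with k
      · rw [← hc.map_mod_nat]; congr 1; omega
      · rw [← ha.map_mod_nat]; congr 1; omega

/-! ### Approximating vectors. -/

/-- A truncated sequence of constant modulus with prescribed ratios of consecutive terms. -/
theorem exists_unit_ell2_mul_conj {s : ℕ → ℂ} (hs : ∀ k, ‖s k‖ = 1) (n : ℕ) :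
    ∃ x : Ell2, ‖x‖ = 1 ∧
      ∀ k, x (k + 1) * conj (x k) = if k < n then s k / (n + 1) else 0 := by
  set u : ℕ → ℂ := fun k => ∏ j ∈ Finset.range k, s j with hu
  have hun : ∀ k, ‖u k‖ = 1 := fun k => by simp [hu, norm_prod, hs]
  have hr : ((√((n : ℝ) + 1))⁻¹) ^ 2 = ((n : ℝ) + 1)⁻¹ := by
    rw [inv_pow, Real.sq_sqrt (by positivity)]
  set r : ℝ := (√((n : ℝ) + 1))⁻¹
  set v : ℕ → ℂ := fun k => if k < n + 1 then r * u k else 0 with hv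
  have hvn : ∀ k, ‖v k‖ ^ 2 = if k < n + 1 then ((n : ℝ) + 1)⁻¹ else 0 := by
    intro k
    by_cases hk : k < n + 1
    · simp only [hv, hk, if_true]
      rw [norm_mul, hun, mul_one, Complex.norm_real, Real.norm_eq_abs, sq_abs, hr]
    · simp only [hv, hk, if_false]
      simp
  have hsum : HasSum (fun k => ‖v k‖ ^ 2) 1 := by
    have h := hasSum_sum_of_ne_finset_zero (L := .unconditional ℕ)
      (f := fun k => ‖v k‖ ^ 2) (s := Finset.range (n + 1))
      (fun k hk => by rw [hvn, if_neg (by simpa using hk)])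
    convert h using 1
    rw [Finset.sum_congr rfl fun k hk => by rw [hvn, if_pos (Finset.mem_range.1 hk)]]
    rw [Finset.sum_const, Finset.card_range, nsmul_eq_mul]
    push_cast
    field_simp
  refine ⟨⟨v, (memlp_two_iff v).2 hsum.summable⟩, ?_, fun k => ?_⟩
  · have h := (Ell2.hasSum_norm_sq ⟨v, (memlp_two_iff v).2 hsum.summable⟩).unique hsum
    exact (pow_eq_one_iff_of_nonneg (norm_nonneg _) two_ne_zero).1 h
  · change v (k + 1) * conj (v k) = _
    by_cases hk : k < n
    · have hk1 : k + 1 < n + 1 := by omega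
      have hk2 : k < n + 1 := by omega
      have huk : u k * conj (u k) = 1 := by rw [Complex.mul_conj']; simp [hun]
      have hrc : (r : ℂ) ^ 2 = ((n : ℂ) + 1)⁻¹ := by
        rw [← Complex.ofReal_pow, hr]
        push_cast
        rfl
      simp only [hv, hk, hk1, hk2, if_true, map_mul, Complex.conj_ofReal]
      rw [show u (k + 1) = u k * s k from Finset.prod_range_succ _ _, div_eq_mul_inv, ← hrc]
      linear_combination (r : ℂ) ^ 2 * s k * huk
    · simp [hv, hk]

/-- The sequence of period four with the values `z₀, z₁, z₂, z₃`. -/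
def fourPeriodic (z₀ z₁ z₂ z₃ : ℂ) (k : ℕ) : ℂ :=
  if k % 4 = 0 then z₀ else if k % 4 = 1 then z₁ else if k % 4 = 2 then z₂ else z₃

theorem sum_ellipseForm_fourPeriodic {a c : ℕ → ℂ} (ha : Function.Periodic a 2)
    (hc : Function.Periodic c 2) (z₀ z₁ z₂ z₃ : ℂ) (N : ℕ) :
    ∑ k ∈ Finset.range (4 * N), ellipseForm (c k) (a (k + 1)) (fourPeriodic z₀ z₁ z₂ z₃ k) =
      N * (ellipseForm (c 0) (a 1) (z₀ + z₂) + ellipseForm (c 1) (a 0) (z₁ + z₃)) := by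
  induction N with
  | zero => simp
  | succ N ih =>
    have hmod : ∀ {f : ℕ → ℂ}, Function.Periodic f 2 → ∀ i, f (4 * N + i) = f (i % 2) := by
      intro f hf i
      rw [← hf.map_mod_nat]
      congr 1
      omega
    have h0 : c (4 * N) = c 0 := hmod hc 0
    rw [show 4 * (N + 1) = 4 * N + 1 + 1 + 1 + 1 by ring]
    simp only [Finset.sum_range_succ, ih]
    simp only [fourPeriodic, add_assoc, hmod ha, hmod hc, h0, Nat.mul_add_mod, Nat.mul_mod_right]
    norm_num [ellipseForm]
    ring

/-- Constant modulus allows only unimodular edge phases, so `p` and `q` are each realized as the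
mean of two phases, whence period four. With `4N` edges on `4N + 1` coordinates the value is `4N /
(4N + 1)` times the target. -/
theorem ellipseSum_subset_closure {a b c : ℕ → ℂ} (ha : Function.Periodic a 2)
    (hb : Function.Periodic b 2) (hc : Function.Periodic c 2) (hb_zero : ∀ k, b k = 0) :
    ellipseSum (c 0) (a 1) (c 1) (a 0) ⊆
      closure (numericalRange (tridiagOp (n := 1) ha hb hc)) := by
  rintro _ ⟨p, q, hp, hq, rfl⟩
  obtain ⟨z₀, z₂, h₀, h₂, hp⟩ := exists_unit_midpoint hp
  obtain ⟨z₁, z₃, h₁, h₃, hq⟩ := exists_unit_midpoint hq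
  set w := ellipseForm (c 0) (a 1) p + ellipseForm (c 1) (a 0) q with hw
  have hs : ∀ k, ‖fourPeriodic z₀ z₁ z₂ z₃ k‖ = 1 := fun k => by
    unfold fourPeriodic
    split_ifs <;> assumption
  have hmem : ∀ N : ℕ, ((4 * N : ℕ) / ((4 * N : ℕ) + 1) : ℂ) * w ∈
      numericalRange (tridiagOp (n := 1) ha hb hc) := by
    intro N
    obtain ⟨x, hx, hxk⟩ := exists_unit_ell2_mul_conj hs (4 * N)
    refine ⟨x, hx, (inner_tridiagOp ha hb hc hb_zero x).unique ?_⟩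
    have hfin := hasSum_sum_of_ne_finset_zero (L := .unconditional ℕ)
      (f := fun k => ellipseForm (c k) (a (k + 1)) (2 * (x (k + 1) * conj (x k))))
      (s := Finset.range (4 * N))
      (fun k hk => by rw [hxk, if_neg (by simpa using hk)]; simp [ellipseForm])
    convert hfin using 1
    have hterm : ∀ k ∈ Finset.range (4 * N),
        ellipseForm (c k) (a (k + 1)) (2 * (x (k + 1) * conj (x k))) =
        2 / ((4 * N : ℕ) + 1) *
          ellipseForm (c k) (a (k + 1)) (fourPeriodic z₀ z₁ z₂ z₃ k) := by
      intro k hk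
      rw [hxk, if_pos (Finset.mem_range.1 hk), ellipseForm_two_mul, ellipseForm, map_div₀,
        map_add, Complex.conj_natCast, map_one]
      ring
    rw [Finset.sum_congr rfl hterm, ← Finset.mul_sum, sum_ellipseForm_fourPeriodic ha hc, hp, hq,
      hw, ellipseForm_two_mul, ellipseForm_two_mul, ellipseForm, ellipseForm]
    push_cast
    ring
  have h4 : Filter.Tendsto (fun N : ℕ => 4 * N) Filter.atTop Filter.atTop :=
    Filter.tendsto_id.const_mul_atTop' (by norm_num)
  have hlim := ((tendsto_natCast_div_add_atTop (1 : ℂ)).comp h4).mul_const w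
  rw [one_mul] at hlim
  exact mem_closure_of_tendsto hlim (Filter.Eventually.of_forall hmem)

theorem proposition2p7 (a b c : ℕ → ℂ)
    (ha : Function.Periodic a 2) (hb : Function.Periodic b 2)
    (hc : Function.Periodic c 2)
    (ha_real : ∀ k, (a k).im = 0) (hc_real : ∀ k, (c k).im = 0) (hb_zero : ∀ k, b k = 0) :
    closure (numericalRange (tridiagOp (n := 1) ha hb hc)) =
      matrixNumericalRange (matrixS (alphaCoeff 1 a c 0) (alphaCoeff 1 a c 1)
        (gammaCoeff 1 a c 0) (gammaCoeff 1 a c 1)) := by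
  have ha1 : conj (a 1) = a 1 := Complex.conj_eq_iff_im.2 (ha_real 1)
  have hc1 : conj (c 1) = c 1 := Complex.conj_eq_iff_im.2 (hc_real 1)
  simp only [alphaCoeff, gammaCoeff, zero_lt_one, lt_irrefl, if_true, if_false, zero_add, ha1, hc1]
  rw [matrixNumericalRange_matrixS]
  exact (closure_minimal (numericalRange_tridiagOp_subset ha hb hc hb_zero)
    (isCompact_ellipseSum _ _ _ _).isClosed).antisymm (ellipseSum_subset_closure ha hb hc hb_zero)
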